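/- Let $k$ be a field and let $\Lambda$ be a finite-dimensional $k$-algebra that is basic, self-injective and representation-finite. All modules are finite-dimensional left modules; $A\text{-mod}$ denotes the category of such modules over a finite-dimensional algebra $A$, and $A\text{-}\underline{\mathrm{mod}}$ its stable category (morphisms modulo those factoring through a projective module), with projection $\pi\colon A\text{-mod}\to A\text{-}\underline{\mathrm{mod}}$ and syzygy functor $\Omega\colon A\text{-}\underline{\mathrm{mod}}\to A\text{-}\underline{\mathrm{mod}}$, where $\Omega X$ is the kernel of an epimorphism $P_X\to X$ with $P_X$ projective. Let $E$ be the basic additive generator of $\Lambda\text{-mod}$ (the basic module with $\mathrm{add}(E)=\Lambda\text{-mod}$), let $\Gamma=\mathrm{End}_\Lambda(E)^{\mathrm{op}}$ be the Auslander algebra, let $e\in\Gamma$ be the idempotent given by a projection of $E$ onto its direct summand $\Lambda$, let $\underline{\Gamma}=\Gamma/\Gamma e\Gamma$ be the stable Auslander algebra, and let $q=\underline{\Gamma}\otimes_\Gamma-\colon\Gamma\text{-mod}\to\underline{\Gamma}\text{-mod}$. For a $\Lambda$-module $M$ write $(E,M)=\mathrm{Hom}_\Lambda(E,M)$, a left $\Gamma$-module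 by precomposition. Let $\mathcal{S}(\Lambda)$ be the full subcategory of monomorphisms in the category of morphisms of $\Lambda\text{-mod}$. For a morphism $h\colon M_1\to M_0$ of $\Lambda$-modules put $\alpha(h)=\mathrm{coker}\big((E,h)\colon(E,M_1)\to(E,M_0)\big)$. Define functors $F,G\colon\mathcal{S}(\Lambda)\to\underline{\Gamma}\text{-mod}$ on $f\colon L\to M$, with cokernel $g\colon M\to N$, by $F(f)=q(\alpha(f))$ and $G(f)=q(\alpha(g))$. Then for every $f\colon L\to M$ in $\mathcal{S}(\Lambda)$, with cokernel $g\colon M\to N$, the sequence of $\underline{\Gamma}$-modules $$0\to F(f)\to q((E,N))\to G(f)\to 0,$$ obtained by applying $q$ to the map $\alpha(f)\to(E,N)$ induced by $(E,g)$ and to the projection $(E,N)\to\alpha(g)$, is exact and natural in $f$, and $q((E,N))$ is a projective $\underline{\Gamma}$-module. Moreover there is a natural isomorphism $$\pi F\cong\Omega\,\pi G$$ of functors $\mathcal{S}(\Lambda)\to\underline{\Gamma}\text{-}\underline{\mathrm{mod}}$, which is induced by these sequences: its component at $f$ is the class of a map $F(f)\to\Omega G(f)$ obtained by restricting some lift $q((E,N))\to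 P_{G(f)}$ of $q((E,N))\to G(f)$. -/

import Mathlib

open CategoryTheory
open scoped TensorProduct

universe v u

/-! ### The category of finite-dimensional left modules -/

/-- A finite-dimensional left module over a `k`-algebra `A`. The `k`-structure is the one induced
from `A` (this is what `IsScalarTower` says). -/
structure FDMod (k : Type v) (A : Type u) [Field k] [Ring A] [Algebra k A] where
  carrier : Type u
  [addCommGroup : AddCommGroup carrier]
  [moduleBase : Module k carrier]
  [module : Module A carrier]
  [isScalarTower : IsScalarTower k A carrier]
  [finite : FiniteDimensional k carrier]

attribute [instance] FDMod.addCommGroup FDMod.moduleBase FDMod.module FDMod.isScalarTower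
  FDMod.finite

namespace FDMod

section

variable {k : Type v} {A : Type u} [Field k] [Ring A] [Algebra k A]

/-- Morphisms of finite-dimensional modules are the `A`-linear maps. -/
@[ext]
structure Hom (X Y : FDMod k A) where
  lin : X.carrier →ₗ[A] Y.carrier

instance : Quiver (FDMod k A) where
  Hom X Y := Hom X Y

instance : Category (FDMod k A) where
  id X := ⟨LinearMap.id⟩
  comp f g := ⟨g.lin.comp f.lin⟩

@[ext]
theorem hom_ext {X Y : FDMod k A} {f g : X ⟶ Y} (h : f.lin = g.lin) : f = g := Hom.ext h

@[simp]
theorem id_lin (X : FDMod k A) : Hom.lin (𝟙 X) = LinearMap.id := rfl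

@[simp]
theorem comp_lin {X Y Z : FDMod k A} (f : X ⟶ Y) (g : Y ⟶ Z) :
    (f ≫ g).lin = g.lin.comp f.lin := rfl

/-- A linear map as a morphism. -/
def ofLin {X Y : FDMod k A} (f : X.carrier →ₗ[A] Y.carrier) : X ⟶ Y := ⟨f⟩

@[simp]
theorem ofLin_lin {X Y : FDMod k A} (f : X.carrier →ₗ[A] Y.carrier) : (ofLin f).lin = f := rfl

/-- Morphisms in the category are the same as linear maps. -/
def homEquiv (X Y : FDMod k A) : (X ⟶ Y) ≃ (X.carrier →ₗ[A] Y.carrier) where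
  toFun f := f.lin
  invFun f := ofLin f
  left_inv _ := rfl
  right_inv _ := rfl

instance (X Y : FDMod k A) : AddCommGroup (X ⟶ Y) := (homEquiv X Y).addCommGroup

@[simp]
theorem add_lin {X Y : FDMod k A} (f g : X ⟶ Y) : (f + g).lin = f.lin + g.lin := rfl

@[simp]
theorem sub_lin {X Y : FDMod k A} (f g : X ⟶ Y) : (f - g).lin = f.lin - g.lin := rfl

@[simp]
theorem neg_lin {X Y : FDMod k A} (f : X ⟶ Y) : (-f).lin = -f.lin := rfl

@[simp]
theorem zero_lin {X Y : FDMod k A} : (0 : X ⟶ Y).lin = 0 := rfl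

instance : Preadditive (FDMod k A) where
  add_comp _ _ _ f f' g := by ext x; simp
  comp_add _ _ _ f g g' := by ext x; simp

/-- `0 → X → Y → Z → 0` is a short exact sequence of modules. -/
def IsShortExact {X Y Z : FDMod k A} (f : X ⟶ Y) (g : Y ⟶ Z) : Prop :=
  Function.Injective f.lin ∧ Function.Exact f.lin g.lin ∧ Function.Surjective g.lin

/-- A module is indecomposable if it is nonzero and is not the direct sum of two nonzero
submodules. -/
def IsIndecomposable (M : FDMod k A) : Prop :=
  Nontrivial M.carrier ∧ ∀ N N' : Submodule A M.carrier, IsCompl N N' → N = ⊥ ∨ N' = ⊥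

/-- A module is basic if it is a finite direct sum of pairwise non-isomorphic indecomposable
modules. -/
def IsBasic (M : FDMod k A) : Prop :=
  ∃ (n : ℕ) (X : Fin n → FDMod k A), (∀ i, (X i).IsIndecomposable) ∧
    (∀ i j, i ≠ j → IsEmpty (X i ≅ X j)) ∧
    Nonempty (M.carrier ≃ₗ[A] ((i : Fin n) → (X i).carrier))

/-- `M` belongs to `add E`: it is a direct summand of a finite direct sum of copies of `E`. -/
def MemAdd (E M : FDMod k A) : Prop :=
  ∃ (n : ℕ) (i : M.carrier →ₗ[A] (Fin n → E.carrier)) (p : (Fin n → E.carrier) →ₗ[A] M.carrier),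
    p.comp i = LinearMap.id

/-- `E` is the additive generator of the category of finite-dimensional modules: the basic module
with `add E` equal to the whole category (unique up to isomorphism). -/
def IsAdditiveGenerator (E : FDMod k A) : Prop :=
  E.IsBasic ∧ ∀ M : FDMod k A, MemAdd E M

end

section

variable (k : Type v) (A : Type u) [Field k] [Ring A] [Algebra k A]

/-- Finite representation type: finitely many isomorphism classes of indecomposables. -/
def _root_.IsRepresentationFinite : Prop :=
  ∃ (n : ℕ) (X : Fin n → FDMod k A), ∀ M : FDMod k A, M.IsIndecomposable → ∃ i, Nonempty (M ≅ X i)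

variable [FiniteDimensional k A]

/-- The free module of rank `n`. -/
def free (n : ℕ) : FDMod k A where
  carrier := Fin n → A

/-- The left regular module. -/
def regular : FDMod k A where
  carrier := A

/-- A finite-dimensional algebra is basic if its left regular module is. -/
def _root_.IsBasicAlgebra : Prop := (regular k A).IsBasic

end

/-! ### The stable category and the syzygy functor -/

section

variable {k : Type v} {A : Type u} [Field k] [Ring A] [Algebra k A]

/-- The morphism factors through a (finite-dimensional) projective module. -/
def FactorsThroughProjective {X Y : FDMod k A} (f : X ⟶ Y) : Prop :=
  ∃ (P : FDMod k A) (g : X ⟶ P) (h : P ⟶ Y), Module.Projective A P.carrier ∧ f = g ≫ h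

/-- Two morphisms agree in the stable category if their difference factors through a projective
module. -/
def stableRel (k : Type v) (A : Type u) [Field k] [Ring A] [Algebra k A] : HomRel (FDMod k A) :=
  fun _ _ f g => FactorsThroughProjective (f - g)

theorem FactorsThroughProjective.zero {X Y : FDMod k A} :
    FactorsThroughProjective (0 : X ⟶ Y) :=
  ⟨{ carrier := PUnit }, 0, 0, (inferInstance : Module.Projective A PUnit.{u + 1}), by simp⟩

theorem FactorsThroughProjective.neg {X Y : FDMod k A} {f : X ⟶ Y}
    (hf : FactorsThroughProjective f) : FactorsThroughProjective (-f) := by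
  obtain ⟨P, g, h, hP, rfl⟩ := hf
  exact ⟨P, -g, h, hP, by simp⟩

theorem FactorsThroughProjective.add {X Y : FDMod k A} {f f' : X ⟶ Y}
    (hf : FactorsThroughProjective f) (hf' : FactorsThroughProjective f') :
    FactorsThroughProjective (f + f') := by
  obtain ⟨P, g, h, hP, rfl⟩ := hf
  obtain ⟨P', g', h', hP', rfl⟩ := hf'
  refine ⟨{ carrier := P.carrier × P'.carrier }, ofLin (g.lin.prod g'.lin),
    ofLin (h.lin.coprod h'.lin), ?_, ?_⟩
  · exact (inferInstance : Module.Projective A (P.carrier × P'.carrier))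
  · ext x
    simp

theorem FactorsThroughProjective.comp_left {X Y Z : FDMod k A} (f : X ⟶ Y) {g : Y ⟶ Z}
    (hg : FactorsThroughProjective g) : FactorsThroughProjective (f ≫ g) := by
  obtain ⟨P, a, b, hP, rfl⟩ := hg
  exact ⟨P, f ≫ a, b, hP, by simp⟩

theorem FactorsThroughProjective.comp_right {X Y Z : FDMod k A} {f : X ⟶ Y} (g : Y ⟶ Z)
    (hf : FactorsThroughProjective f) : FactorsThroughProjective (f ≫ g) := by
  obtain ⟨P, a, b, hP, rfl⟩ := hf
  exact ⟨P, a, b ≫ g, hP, by simp⟩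

instance : Congruence (stableRel k A) where
  equivalence :=
    { refl := fun f => by
        simpa [stableRel] using FactorsThroughProjective.zero
      symm := fun {f g} h => by
        have := FactorsThroughProjective.neg h
        rwa [neg_sub] at this
      trans := fun {f g h} h₁ h₂ => by
        have := FactorsThroughProjective.add h₁ h₂
        rwa [sub_add_sub_cancel] at this }
  comp_left f _ _ h := by
    have := FactorsThroughProjective.comp_left f h
    rwa [Preadditive.comp_sub] at this
  comp_right g h := by
    have := FactorsThroughProjective.comp_right g h
    rwa [Preadditive.sub_comp] at this

variable (k A) in
/-- The stable module category: modules, with morphisms modulo those factoring through a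
projective module. -/
abbrev StableMod := CategoryTheory.Quotient (stableRel k A)

variable (k A) in
/-- The projection to the stable category. -/
abbrev toStable : FDMod k A ⥤ StableMod k A := CategoryTheory.Quotient.functor (stableRel k A)

/-- Lifting along epimorphisms from projective modules. -/
theorem exists_lift {P X Y : FDMod k A} (hP : Module.Projective A P.carrier) (p : X ⟶ Y)
    (hp : Function.Surjective p.lin) (f : P ⟶ Y) : ∃ w : P ⟶ X, w ≫ p = f := by
  obtain ⟨w, hw⟩ := Module.projective_lifting_property p.lin f.lin hp
  exact ⟨ofLin w, hom_ext hw⟩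

theorem stableRel_refl {X Y : FDMod k A} (f : X ⟶ Y) : FDMod.stableRel k A f f :=
  (inferInstance : Congruence (FDMod.stableRel k A)).equivalence.refl f

variable [FiniteDimensional k A]

theorem exists_cover (M : FDMod k A) :
    ∃ (n : ℕ) (p : free k A n ⟶ M), Function.Surjective p.lin := by
  have : Module.Finite A M.carrier := Module.Finite.of_restrictScalars_finite k A M.carrier
  obtain ⟨n, f, hf⟩ := Module.Finite.exists_fin' A M.carrier
  exact ⟨n, ofLin (X := free k A n) f, hf⟩

/-- A chosen free module of finite rank covering `M`. -/
noncomputable def cover (M : FDMod k A) : FDMod k A := free k A (exists_cover M).choose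

/-- The chosen epimorphism from a free module of finite rank onto `M`. -/
noncomputable def coverMap (M : FDMod k A) : cover M ⟶ M := (exists_cover M).choose_spec.choose

theorem coverMap_surjective (M : FDMod k A) : Function.Surjective (coverMap M).lin :=
  (exists_cover M).choose_spec.choose_spec

theorem cover_projective (M : FDMod k A) : Module.Projective A (cover M).carrier :=
  (inferInstance : Module.Projective A (Fin _ → A))

/-- The syzygy of `M`: the kernel of the chosen epimorphism from a projective module onto `M`. -/
noncomputable def syzygy (M : FDMod k A) : FDMod k A where
  carrier := LinearMap.ker (coverMap M).lin
  finite := FiniteDimensional.of_injective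
    ((LinearMap.ker (coverMap M).lin).subtype.restrictScalars k) Subtype.val_injective

/-- The inclusion of the syzygy in the chosen free cover. -/
noncomputable def syzygyInc (M : FDMod k A) : syzygy M ⟶ cover M :=
  ofLin (X := syzygy M) (LinearMap.ker (coverMap M).lin).subtype

theorem syzygyInc_injective (M : FDMod k A) : Function.Injective (syzygyInc M).lin :=
  Subtype.val_injective

theorem syzygyInc_comp (M : FDMod k A) : syzygyInc M ≫ coverMap M = 0 := by
  ext x
  exact x.2

/-- `u` is induced on syzygies by some lift of `f` to the chosen free covers. -/
def IsSyzygyMap {X Y : FDMod k A} (f : X ⟶ Y) (u : syzygy X ⟶ syzygy Y) : Prop :=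
  ∃ w : cover X ⟶ cover Y, w ≫ coverMap Y = coverMap X ≫ f ∧ syzygyInc X ≫ w = u ≫ syzygyInc Y

/-- A map to the chosen free cover of `Y` that vanishes in `Y` factors through the syzygy. -/
theorem exists_factor_syzygy {X Y : FDMod k A} (w : X ⟶ cover Y) (h : w ≫ coverMap Y = 0) :
    ∃ u : X ⟶ syzygy Y, u ≫ syzygyInc Y = w :=
  ⟨ofLin (Y := syzygy Y) (LinearMap.codRestrict (LinearMap.ker (coverMap Y).lin) w.lin
    fun x => LinearMap.congr_fun (congrArg Hom.lin h) x), rfl⟩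

theorem exists_isSyzygyMap {X Y : FDMod k A} (f : X ⟶ Y) : ∃ u, IsSyzygyMap f u := by
  obtain ⟨w, hw⟩ := exists_lift (cover_projective X) (coverMap Y) (coverMap_surjective Y)
    (coverMap X ≫ f)
  obtain ⟨u, hu⟩ := exists_factor_syzygy (syzygyInc X ≫ w) (by
    rw [Category.assoc, hw, ← Category.assoc, syzygyInc_comp, Limits.zero_comp])
  exact ⟨u, w, hw, hu.symm⟩

theorem IsSyzygyMap.stableRel {X Y : FDMod k A} {f f' : X ⟶ Y} {u u' : syzygy X ⟶ syzygy Y}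
    (hu : IsSyzygyMap f u) (hu' : IsSyzygyMap f' u') (h : FDMod.stableRel k A f f') :
    FDMod.stableRel k A u u' := by
  obtain ⟨w, hw, hwu⟩ := hu
  obtain ⟨w', hw', hwu'⟩ := hu'
  obtain ⟨P, a, b, hP, hab⟩ := h
  obtain ⟨c, hc⟩ := exists_lift hP (coverMap Y) (coverMap_surjective Y) b
  obtain ⟨d, hd⟩ := exists_factor_syzygy (w - w' - coverMap X ≫ a ≫ c) (by
    simp only [Preadditive.sub_comp, Category.assoc, hw, hw', hc, ← hab, Preadditive.comp_sub,
      sub_self])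
  refine ⟨cover X, syzygyInc X, d, cover_projective X, ?_⟩
  have hmono : ∀ {Z : FDMod k A} (s t : Z ⟶ syzygy Y),
      s ≫ syzygyInc Y = t ≫ syzygyInc Y → s = t := by
    intro Z s t hst
    ext x
    exact syzygyInc_injective Y (LinearMap.congr_fun (congrArg Hom.lin hst) x)
  apply hmono
  rw [Preadditive.sub_comp, ← hwu, ← hwu', Category.assoc, hd, Preadditive.comp_sub,
    Preadditive.comp_sub, ← Category.assoc (syzygyInc X) (coverMap X), syzygyInc_comp,
    Limits.zero_comp, sub_zero]

theorem IsSyzygyMap.id (X : FDMod k A) : IsSyzygyMap (𝟙 X) (𝟙 (syzygy X)) :=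
  ⟨𝟙 _, by simp, by simp⟩

theorem IsSyzygyMap.comp {X Y Z : FDMod k A} {f : X ⟶ Y} {g : Y ⟶ Z} {u : syzygy X ⟶ syzygy Y}
    {t : syzygy Y ⟶ syzygy Z} (hu : IsSyzygyMap f u) (ht : IsSyzygyMap g t) :
    IsSyzygyMap (f ≫ g) (u ≫ t) := by
  obtain ⟨w, hw, hwu⟩ := hu
  obtain ⟨w', hw', hwt⟩ := ht
  refine ⟨w ≫ w', ?_, ?_⟩
  · rw [Category.assoc, hw', ← Category.assoc, hw, Category.assoc]
  · rw [← Category.assoc, hwu, Category.assoc, hwt, Category.assoc]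

/-- A chosen map on syzygies induced by `f`. -/
noncomputable def syzygyMap {X Y : FDMod k A} (f : X ⟶ Y) : syzygy X ⟶ syzygy Y :=
  (exists_isSyzygyMap f).choose

theorem syzygyMap_spec {X Y : FDMod k A} (f : X ⟶ Y) : IsSyzygyMap f (syzygyMap f) :=
  (exists_isSyzygyMap f).choose_spec

variable (k A) in
/-- The syzygy as a functor from modules to the stable category. -/
noncomputable def syzygyToStable : FDMod k A ⥤ StableMod k A where
  obj X := (toStable k A).obj (syzygy X)
  map f := (toStable k A).map (syzygyMap f)
  map_id X := by
    rw [← (toStable k A).map_id]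
    exact CategoryTheory.Quotient.sound _ ((syzygyMap_spec _).stableRel (IsSyzygyMap.id X) (stableRel_refl _))
  map_comp f g := by
    rw [← (toStable k A).map_comp]
    exact CategoryTheory.Quotient.sound _ ((syzygyMap_spec _).stableRel
      ((syzygyMap_spec f).comp (syzygyMap_spec g)) (stableRel_refl _))

variable (k A) in
/-- The syzygy functor on the stable category. -/
noncomputable def Ω : StableMod k A ⥤ StableMod k A :=
  CategoryTheory.Quotient.lift _ (syzygyToStable k A) fun _ _ f g h =>
    CategoryTheory.Quotient.sound _ ((syzygyMap_spec f).stableRel (syzygyMap_spec g) h)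

end

/-! ### Cokernels -/

section

variable {k : Type v} {A : Type u} [Field k] [Ring A] [Algebra k A]

theorem finite_quotient (M : Type u) [AddCommGroup M] [Module k M] [Module A M]
    [IsScalarTower k A M] [FiniteDimensional k M] (N : Submodule A M) :
    FiniteDimensional k (M ⧸ N) :=
  Module.Finite.of_surjective (N.mkQ.restrictScalars k) N.mkQ_surjective

/-- The cokernel of a morphism. -/
def cok {X Y : FDMod k A} (f : X ⟶ Y) : FDMod k A where
  carrier := Y.carrier ⧸ LinearMap.range f.lin
  finite := finite_quotient Y.carrier (LinearMap.range f.lin)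

/-- The projection onto the cokernel. -/
def cokProj {X Y : FDMod k A} (f : X ⟶ Y) : Y ⟶ cok f :=
  ofLin (Y := cok f) (LinearMap.range f.lin).mkQ

/-- The map on cokernels induced by a map from the target that kills the image. -/
def cokDesc {X Y Z : FDMod k A} (f : X ⟶ Y) (g : Y ⟶ Z) (h : f ≫ g = 0) : cok f ⟶ Z :=
  ofLin (X := cok f) ((LinearMap.range f.lin).liftQ g.lin (by
    rintro _ ⟨x, rfl⟩
    exact LinearMap.congr_fun (congrArg Hom.lin h) x))

@[simp]
theorem comp_cokProj {X Y : FDMod k A} (f : X ⟶ Y) : f ≫ cokProj f = 0 := by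
  ext x
  exact (Submodule.Quotient.mk_eq_zero (LinearMap.range f.lin)).2 (LinearMap.mem_range_self f.lin x)

@[simp]
theorem cokProj_desc {X Y Z : FDMod k A} (f : X ⟶ Y) (g : Y ⟶ Z) (h : f ≫ g = 0) :
    cokProj f ≫ cokDesc f g h = g := rfl

theorem cok_hom_ext {X Y Z : FDMod k A} {f : X ⟶ Y} {s t : cok f ⟶ Z}
    (h : cokProj f ≫ s = cokProj f ≫ t) : s = t := by
  ext x
  obtain ⟨y, rfl⟩ := Submodule.mkQ_surjective _ x
  exact LinearMap.congr_fun (congrArg Hom.lin h) y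

variable (k A) in
/-- The cokernel as a functor on the category of morphisms. -/
def cokFunctor : Arrow (FDMod k A) ⥤ FDMod k A where
  obj f := cok f.hom
  map {f g} a := cokDesc f.hom (a.right ≫ cokProj g.hom) (by
    rw [← Category.assoc, ← Arrow.w a, Category.assoc, comp_cokProj, Limits.comp_zero])
  map_id f := cok_hom_ext (by simp)
  map_comp a b := cok_hom_ext (by
    rw [cokProj_desc, ← Category.assoc, cokProj_desc, Category.assoc, cokProj_desc,
      Arrow.comp_right, Category.assoc])

/-- The submodule category: the full subcategory of monomorphisms in the category of morphisms. -/
abbrev SubmoduleCategory (k : Type v) (A : Type u) [Field k] [Ring A] [Algebra k A] :=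
  ObjectProperty.FullSubcategory (fun f : Arrow (FDMod k A) => Function.Injective f.hom.lin)

variable (k A) in
/-- The inclusion `η` of the submodule category. -/
abbrev eta : SubmoduleCategory k A ⥤ Arrow (FDMod k A) := ObjectProperty.ι _

variable (k A) in
/-- The functor `ε`, sending a monomorphism to the projection onto its cokernel. -/
def epsilon : SubmoduleCategory k A ⥤ Arrow (FDMod k A) where
  obj f := Arrow.mk (cokProj f.obj.hom)
  map {f g} a := Arrow.homMk a.hom.right ((cokFunctor k A).map a.hom) rfl
  map_id f := by
    ext1
    · rfl
    · exact (cokFunctor k A).map_id _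
  map_comp a b := by
    ext1
    · rfl
    · exact (cokFunctor k A).map_comp _ _

end

/-! ### Tensoring up along an algebra homomorphism -/

section

variable {k : Type v} {A B : Type u} [Field k] [Ring A] [Algebra k A] [Ring B] [Algebra k B]

/-- The relations `b φ(a) ⊗ m = b ⊗ a m`, so that `B ⊗_A M` is the quotient of `B ⊗_k M` by
them (they span the same additive subgroup as left `B`-submodule). -/
def balanced (φ : A →ₐ[k] B) (M : FDMod k A) : Submodule B (B ⊗[k] M.carrier) :=
  Submodule.span B
    {t | ∃ (b : B) (a : A) (m : M.carrier), t = (b * φ a) ⊗ₜ[k] m - b ⊗ₜ[k] (a • m)}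

theorem balanced_le_comap (φ : A →ₐ[k] B) {M N : FDMod k A} (f : M ⟶ N) :
    balanced φ M ≤ (balanced φ N).comap
      (TensorProduct.AlgebraTensorModule.lTensor B B (f.lin.restrictScalars k)) := by
  rw [balanced, Submodule.span_le]
  rintro _ ⟨b, a, m, rfl⟩
  refine Submodule.subset_span ⟨b, a, f.lin m, ?_⟩
  simp

variable [FiniteDimensional k B]

/-- The left `B`-module `B ⊗_A M`, where `B` is a right `A`-module through `φ`. -/
def tensorObj (φ : A →ₐ[k] B) (M : FDMod k A) : FDMod k B where
  carrier := (B ⊗[k] M.carrier) ⧸ balanced φ M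
  finite := finite_quotient (B ⊗[k] M.carrier) (balanced φ M)

/-- The pure tensors in `B ⊗_A M`. -/
def tensorTmul (φ : A →ₐ[k] B) (M : FDMod k A) (b : B) (m : M.carrier) :
    (tensorObj φ M).carrier :=
  (balanced φ M).mkQ (b ⊗ₜ[k] m)

theorem tensor_hom_ext {φ : A →ₐ[k] B} {M : FDMod k A} {N : FDMod k B} {s t : tensorObj φ M ⟶ N}
    (h : ∀ b m, s.lin (tensorTmul φ M b m) = t.lin (tensorTmul φ M b m)) : s = t := by
  refine hom_ext (Submodule.linearMap_qext (balanced φ M) (LinearMap.ext fun y => ?_))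
  induction y using TensorProduct.induction_on with
  | zero => rw [map_zero, map_zero]
  | tmul b m => exact h b m
  | add y z hy hz => rw [map_add, map_add, hy, hz]

/-- The functor `B ⊗_A -`. -/
def tensorFunctor (φ : A →ₐ[k] B) : FDMod k A ⥤ FDMod k B where
  obj M := tensorObj φ M
  map {M N} f := ofLin (X := tensorObj φ M) (Y := tensorObj φ N)
    (Submodule.mapQ (balanced φ M) (balanced φ N)
      (TensorProduct.AlgebraTensorModule.lTensor B B (f.lin.restrictScalars k))
      (balanced_le_comap φ f))
  map_id _ := tensor_hom_ext fun _ _ => rfl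
  map_comp _ _ := tensor_hom_ext fun _ _ => rfl

end

/-! ### The Auslander algebra, the stable Auslander algebra and the functors -/

section

variable {k : Type v} {Λ : Type u} [Field k] [Ring Λ] [Algebra k Λ]

instance homSMulCommClass (M : FDMod k Λ) : SMulCommClass Λ k M.carrier :=
  IsScalarTower.to_smulCommClass'

instance finite_hom (M N : FDMod k Λ) : FiniteDimensional k (M.carrier →ₗ[Λ] N.carrier) :=
  FiniteDimensional.of_injective
    (LinearMap.restrictScalarsₗ k Λ M.carrier N.carrier k) (LinearMap.restrictScalars_injective k)

/-- The opposite of the endomorphism algebra of `E`; for `E` the additive generator this is the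
Auslander algebra `Γ` of `Λ`. -/
abbrev AuslanderAlgebra (E : FDMod k Λ) : Type u := (Module.End Λ E.carrier)ᵐᵒᵖ

instance finite_auslander (E : FDMod k Λ) : FiniteDimensional k (AuslanderAlgebra E) :=
  Module.Finite.equiv (MulOpposite.opLinearEquiv k : Module.End Λ E.carrier ≃ₗ[k] _)

/-- `Hom(E, M)` is a left module over `End(E)ᵒᵖ` by precomposition. -/
@[reducible]
def precompModule (E M : FDMod k Λ) :
    Module (AuslanderAlgebra E) (E.carrier →ₗ[Λ] M.carrier) where
  smul γ h := h.comp γ.unop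
  one_smul _ := rfl
  mul_smul _ _ _ := rfl
  smul_zero _ := rfl
  smul_add _ _ _ := rfl
  add_smul _ _ h := LinearMap.comp_add _ _ h
  zero_smul h := LinearMap.comp_zero h

/-- The `Γ`-module `(E, M)`. -/
def homObj (E M : FDMod k Λ) : FDMod k (AuslanderAlgebra E) :=
  letI := precompModule E M
  { carrier := E.carrier →ₗ[Λ] M.carrier
    isScalarTower := ⟨fun c γ h => LinearMap.ext fun x =>
      LinearMap.map_smul_of_tower h c (γ.unop x)⟩ }

/-- The functor `(E, -)` from `Λ`-modules to `Γ`-modules. -/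
def homFunctor (E : FDMod k Λ) : FDMod k Λ ⥤ FDMod k (AuslanderAlgebra E) where
  obj M := homObj E M
  map {M N} f := ofLin (X := homObj E M) (Y := homObj E N)
    { toFun := fun h => f.lin.comp h
      map_add' := fun h h' => LinearMap.comp_add h h' f.lin
      map_smul' := fun _ _ => rfl }

/-- The functor `α`, sending `f : M₁ → M₀` to the cokernel of `(E, f) : (E, M₁) → (E, M₀)`. -/
def alpha (E : FDMod k Λ) : Arrow (FDMod k Λ) ⥤ FDMod k (AuslanderAlgebra E) :=
  (homFunctor E).mapArrow ⋙ cokFunctor k (AuslanderAlgebra E)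

/-- A realization of the left regular module as a direct summand of `E`. -/
structure RegularSummand (E : FDMod k Λ) where
  inc : Λ →ₗ[Λ] E.carrier
  proj : E.carrier →ₗ[Λ] Λ
  proj_comp_inc : proj.comp inc = LinearMap.id

/-- The idempotent `e` of `Γ` given by the projection of `E` onto its summand `Λ`. -/
def RegularSummand.idem {E : FDMod k Λ} (s : RegularSummand E) : AuslanderAlgebra E :=
  MulOpposite.op (s.inc.comp s.proj)

/-- The stable Auslander algebra `Γ / ΓeΓ`. -/
abbrev StableAuslanderAlgebra {E : FDMod k Λ} (s : RegularSummand E) : Type u :=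
  (TwoSidedIdeal.span {s.idem}).ringCon.Quotient

/-- The projection `Γ → Γ / ΓeΓ`. -/
def quotMap {E : FDMod k Λ} (s : RegularSummand E) :
    AuslanderAlgebra E →ₐ[k] StableAuslanderAlgebra s :=
  RingCon.mkₐ k (TwoSidedIdeal.span {s.idem}).ringCon

instance finite_stableAuslander {E : FDMod k Λ} (s : RegularSummand E) :
    FiniteDimensional k (StableAuslanderAlgebra s) :=
  Module.Finite.of_surjective (quotMap (k := k) s).toLinearMap
    (RingCon.mkₐ_surjective (α := k) (TwoSidedIdeal.span {s.idem}).ringCon)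

/-- The functor `q = Γ / ΓeΓ ⊗_Γ -`. -/
def q {E : FDMod k Λ} (s : RegularSummand E) :
    FDMod k (AuslanderAlgebra E) ⥤ FDMod k (StableAuslanderAlgebra s) :=
  tensorFunctor (quotMap s)

/-- The functor `F = q α η`. -/
def functorF {E : FDMod k Λ} (s : RegularSummand E) :
    SubmoduleCategory k Λ ⥤ FDMod k (StableAuslanderAlgebra s) :=
  eta k Λ ⋙ alpha E ⋙ q s

/-- The functor `G = q α ε`. -/
def functorG {E : FDMod k Λ} (s : RegularSummand E) :
    SubmoduleCategory k Λ ⥤ FDMod k (StableAuslanderAlgebra s) :=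
  epsilon k Λ ⋙ alpha E ⋙ q s

/-- The functor sending a monomorphism `f` with cokernel `N` to `q((E, N))`. -/
def functorMid {E : FDMod k Λ} (s : RegularSummand E) :
    SubmoduleCategory k Λ ⥤ FDMod k (StableAuslanderAlgebra s) :=
  (eta k Λ ⋙ cokFunctor k Λ) ⋙ homFunctor E ⋙ q s

theorem homFunctor_comp_cokProj (E : FDMod k Λ) {L M : FDMod k Λ} (f : L ⟶ M) :
    (homFunctor E).map f ≫ (homFunctor E).map (cokProj f) = 0 := by
  rw [← Functor.map_comp, comp_cokProj]
  exact hom_ext (LinearMap.ext fun h => LinearMap.zero_comp h)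

/-- The natural map `α η (f) → (E, N)` induced by `(E, g)`, with `g : M → N` the cokernel
of `f : L → M`. -/
def alphaToHom (E : FDMod k Λ) :
    eta k Λ ⋙ alpha E ⟶ (eta k Λ ⋙ cokFunctor k Λ) ⋙ homFunctor E where
  app f := cokDesc ((homFunctor E).map f.obj.hom) ((homFunctor E).map (cokProj f.obj.hom))
    (homFunctor_comp_cokProj E f.obj.hom)
  naturality f g a := cok_hom_ext (by
    ext h
    rfl)

/-- The natural projection `(E, N) → α ε (f)` onto the cokernel of `(E, g)`, with `g : M → N` the
cokernel of `f : L → M`. -/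
def homToAlpha (E : FDMod k Λ) :
    (eta k Λ ⋙ cokFunctor k Λ) ⋙ homFunctor E ⟶ epsilon k Λ ⋙ alpha E where
  app f := cokProj ((homFunctor E).map (cokProj f.obj.hom))
  naturality _ _ _ := rfl

/-- The natural map `F(f) → q((E, N))`. -/
def fromF {E : FDMod k Λ} (s : RegularSummand E) : functorF s ⟶ functorMid s :=
  Functor.whiskerRight (alphaToHom E) (q s)

/-- The natural map `q((E, N)) → G(f)`. -/
def toG {E : FDMod k Λ} (s : RegularSummand E) : functorMid s ⟶ functorG s :=
  Functor.whiskerRight (homToAlpha E) (q s)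

end

end FDMod

namespace FDMod

/-! ### Maps induced on kernels -/

section

variable {k : Type v} {A : Type u} [Field k] [Ring A] [Algebra k A]

/-! Left exactness of `(E, -)` makes `0 → α(f) → (E, N) → α(g) → 0` exact over `Γ`
(`isShortExact_alpha`). The functor `q` is only right exact in general, but `e` annihilates `α(g)`:
maps out of `Λ` lift along the epimorphism `g` (`idem_smul_alpha`). Hence `e(E, N)` already lies in
`α(f)`, and since `e = e²` the ideal `I = ΓeΓ` satisfies `I(E, N) ⊆ I α(f)`. As `q` is `M ↦ M / IM`
(`tensorUnit_eq_zero`), injectivity on the left survives (`IsShortExact.tensor`).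

The middle term is projective because `N` lies in `add E`, so that `(E, N)` is a summand of a free
`Γ`-module, and base change preserves projectivity.

The stable isomorphism is then formal. Over a fixed map of right ends, any two induced maps of left
ends differ by a map through the projective middle term. This gives both invertibility of the
comparison with the chosen syzygy (Schanuel) and its naturality (`exists_iso_syzygy`). -/

theorem IsShortExact.comp_eq_zero {X P Y : FDMod k A} {i : X ⟶ P} {p : P ⟶ Y}
    (h : IsShortExact i p) : i ≫ p = 0 :=
  hom_ext (LinearMap.ext fun x => h.2.1.apply_apply_eq_zero x)

theorem IsShortExact.hom_ext {X P Y : FDMod k A} {i : X ⟶ P} {p : P ⟶ Y}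
    (h : IsShortExact i p) {Z : FDMod k A} {a b : Z ⟶ X} (hab : a ≫ i = b ≫ i) : a = b :=
  FDMod.hom_ext (LinearMap.ext fun x => h.1 (LinearMap.congr_fun (congrArg Hom.lin hab) x))

theorem IsShortExact.exists_factor {X P Y : FDMod k A} {i : X ⟶ P} {p : P ⟶ Y}
    (h : IsShortExact i p) {Z : FDMod k A} (w : Z ⟶ P) (hw : w ≫ p = 0) :
    ∃ t : Z ⟶ X, t ≫ i = w := by
  have hmem : ∀ z, w.lin z ∈ LinearMap.range i.lin := fun z =>
    (h.2.1 (w.lin z)).1 (LinearMap.congr_fun (congrArg Hom.lin hw) z)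
  refine ⟨ofLin ((LinearEquiv.ofInjective i.lin h.1).symm.toLinearMap.comp
    (LinearMap.codRestrict (LinearMap.range i.lin) w.lin hmem)),
    FDMod.hom_ext (LinearMap.ext fun z => ?_)⟩
  exact congrArg Subtype.val ((LinearEquiv.ofInjective i.lin h.1).apply_symm_apply ⟨w.lin z, hmem z⟩)

/-- `u` is induced on kernels by some lift of `f`. -/
def IsKernelMap {X P Y X' P' Y' : FDMod k A} (i : X ⟶ P) (p : P ⟶ Y) (i' : X' ⟶ P') (p' : P' ⟶ Y')
    (f : Y ⟶ Y') (u : X ⟶ X') : Prop :=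
  ∃ w : P ⟶ P', w ≫ p' = p ≫ f ∧ i ≫ w = u ≫ i'

theorem IsKernelMap.id {X P Y : FDMod k A} (i : X ⟶ P) (p : P ⟶ Y) :
    IsKernelMap i p i p (𝟙 Y) (𝟙 X) :=
  ⟨𝟙 P, by simp, by simp⟩

theorem IsKernelMap.comp {X P Y X' P' Y' X'' P'' Y'' : FDMod k A} {i : X ⟶ P} {p : P ⟶ Y}
    {i' : X' ⟶ P'} {p' : P' ⟶ Y'} {i'' : X'' ⟶ P''} {p'' : P'' ⟶ Y''} {f : Y ⟶ Y'} {u : X ⟶ X'}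
    {g : Y' ⟶ Y''} {t : X' ⟶ X''} (hu : IsKernelMap i p i' p' f u)
    (ht : IsKernelMap i' p' i'' p'' g t) : IsKernelMap i p i'' p'' (f ≫ g) (u ≫ t) := by
  obtain ⟨w, hw, hwu⟩ := hu
  obtain ⟨w', hw', hwt⟩ := ht
  refine ⟨w ≫ w', ?_, ?_⟩
  · rw [Category.assoc, hw', ← Category.assoc, hw, Category.assoc]
  · rw [← Category.assoc, hwu, Category.assoc, hwt, Category.assoc]

/-- The comparison step for resolutions: projectivity is needed only in the source row, exactness
only in the target row. -/
theorem exists_isKernelMap {X P Y X' P' Y' : FDMod k A} {i : X ⟶ P} {p : P ⟶ Y} {i' : X' ⟶ P'}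
    {p' : P' ⟶ Y'} (hP : Module.Projective A P.carrier) (h : i ≫ p = 0) (h' : IsShortExact i' p')
    (f : Y ⟶ Y') : ∃ u, IsKernelMap i p i' p' f u := by
  obtain ⟨w, hw⟩ := exists_lift hP p' h'.2.2 (p ≫ f)
  obtain ⟨u, hu⟩ := h'.exists_factor (i ≫ w) (by
    rw [Category.assoc, hw, ← Category.assoc, h, Limits.zero_comp])
  exact ⟨u, w, hw, hu.symm⟩

/-- Two lifts of `f` differ by a map that dies in `Y'`, hence by one of the form `d ≫ i'` with `d :
P ⟶ X'`. Cancelling `i'` gives `u - t = i ≫ d`, which passes through `P`. -/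
theorem IsKernelMap.stableRel {X P Y X' P' Y' : FDMod k A} {i : X ⟶ P} {p : P ⟶ Y} {i' : X' ⟶ P'}
    {p' : P' ⟶ Y'} (hP : Module.Projective A P.carrier) (h' : IsShortExact i' p')
    {f : Y ⟶ Y'} {u t : X ⟶ X'} (hu : IsKernelMap i p i' p' f u)
    (ht : IsKernelMap i p i' p' f t) : FDMod.stableRel k A u t := by
  obtain ⟨w, hw, hwu⟩ := hu
  obtain ⟨w', hw', hwt⟩ := ht
  obtain ⟨d, hd⟩ := h'.exists_factor (w - w') (by rw [Preadditive.sub_comp, hw, hw', sub_self])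
  refine ⟨P, i, d, hP, h'.hom_ext ?_⟩
  rw [Preadditive.sub_comp, ← hwu, ← hwt, Category.assoc, hd, Preadditive.comp_sub]

/-- Two short exact sequences with the same right end and projective middle terms have stably
isomorphic left ends. -/
theorem IsKernelMap.isIso_toStable {X P X' P' Y : FDMod k A} {i : X ⟶ P} {p : P ⟶ Y}
    {i' : X' ⟶ P'} {p' : P' ⟶ Y} (hP : Module.Projective A P.carrier)
    (hP' : Module.Projective A P'.carrier) (h : IsShortExact i p) (h' : IsShortExact i' p')
    {u : X ⟶ X'} (hu : IsKernelMap i p i' p' (𝟙 Y) u) : IsIso ((toStable k A).map u) := by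
  obtain ⟨t, ht⟩ := exists_isKernelMap hP' h'.comp_eq_zero h (𝟙 Y)
  refine ⟨(toStable k A).map t, ?_, ?_⟩
  · rw [← Functor.map_comp, ← CategoryTheory.Functor.map_id]
    -- The round trip and the identity of `X` are both induced by the identity of `Y`, so they agree
    -- stably.
    refine CategoryTheory.Quotient.sound _ (IsKernelMap.stableRel hP h (hu.comp ht) ?_)
    rw [Category.comp_id]
    exact IsKernelMap.id i p
  · rw [← Functor.map_comp, ← CategoryTheory.Functor.map_id]
    refine CategoryTheory.Quotient.sound _ (IsKernelMap.stableRel hP' h' (ht.comp hu) ?_)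
    rw [Category.comp_id]
    exact IsKernelMap.id i' p'

variable [FiniteDimensional k A]

theorem isShortExact_syzygy (M : FDMod k A) : IsShortExact (syzygyInc M) (coverMap M) :=
  ⟨syzygyInc_injective M, fun x => ⟨fun hx => ⟨⟨x, hx⟩, rfl⟩, by rintro ⟨y, rfl⟩; exact y.2⟩,
    coverMap_surjective M⟩

/-- A natural short exact sequence with projective middle terms identifies its left end with the
syzygy of its right end in the stable category. -/
theorem exists_iso_syzygy {C : Type*} [Category C] {F P G : C ⥤ FDMod k A} (i : F ⟶ P) (p : P ⟶ G)
    (h : ∀ c, IsShortExact (i.app c) (p.app c))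
    (hP : ∀ c, Module.Projective A (P.obj c).carrier) :
    ∃ Φ : F ⋙ toStable k A ≅ (G ⋙ toStable k A) ⋙ Ω k A, ∀ c,
      ∃ (w : P.obj c ⟶ cover (G.obj c)) (t : F.obj c ⟶ syzygy (G.obj c)),
        w ≫ coverMap (G.obj c) = p.app c ∧ i.app c ≫ w = t ≫ syzygyInc (G.obj c) ∧
        Φ.hom.app c = (toStable k A).map t := by
  choose t ht using fun c => exists_isKernelMap (hP c) (h c).comp_eq_zero
    (isShortExact_syzygy (G.obj c)) (𝟙 (G.obj c))
  have hiso : ∀ c, IsIso ((toStable k A).map (t c)) := fun c =>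
    (ht c).isIso_toStable (hP c) (cover_projective _) (h c) (isShortExact_syzygy _)
  refine ⟨NatIso.ofComponents (F := F ⋙ toStable k A) (G := (G ⋙ toStable k A) ⋙ Ω k A)
    (fun c => @asIso _ _ _ _ ((toStable k A).map (t c)) (hiso c)) fun {c d} a => ?_, fun c => ?_⟩
  · change (toStable k A).map (F.map a) ≫ (toStable k A).map (t d) =
      (toStable k A).map (t c) ≫ (toStable k A).map (syzygyMap (G.map a))
    rw [← Functor.map_comp, ← Functor.map_comp]
    -- Both ways around the square are induced by `G.map a`, from the sequence at `c` to the syzygy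
    -- sequence at `d`; uniqueness up to projectives then makes the square commute.
    have h₁ : IsKernelMap (i.app c) (p.app c) (i.app d) (p.app d) (G.map a) (F.map a) :=
      ⟨P.map a, p.naturality a, (i.naturality a).symm⟩
    have h₂ := h₁.comp (ht d)
    have h₃ := (ht c).comp (show IsKernelMap _ _ _ _ _ _ from syzygyMap_spec (G.map a))
    rw [Category.comp_id] at h₂
    rw [Category.id_comp] at h₃
    exact CategoryTheory.Quotient.sound _ (h₂.stableRel (hP c) (isShortExact_syzygy _) h₃)
  · obtain ⟨w, hw, hwt⟩ := ht c
    exact ⟨w, t c, by rw [hw, Category.comp_id], hwt, rfl⟩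

end

/-! ### Tensoring up along an algebra homomorphism -/

section

variable {k : Type v} {A B : Type u} [Field k] [Ring A] [Algebra k A] [Ring B] [Algebra k B]
  {φ : A →ₐ[k] B} {M : FDMod k A}

variable (φ M) in
/-- The submodule `I M` of `M`, where `I` is the kernel of `φ`. -/
def kerSMul : Submodule A M.carrier :=
  Submodule.span A {x | ∃ (a : A) (m : M.carrier), φ a = 0 ∧ x = a • m}

theorem smul_mem_kerSMul {a : A} (ha : φ a = 0) (m : M.carrier) : a • m ∈ kerSMul φ M :=
  Submodule.subset_span ⟨a, m, ha, rfl⟩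

/-- Generators `a • n` lift by lifting `n`. This supplies the correction term for exactness in the
middle after base change. -/
theorem kerSMul_le_map {N : FDMod k A} (p : M ⟶ N) (hp : Function.Surjective p.lin) :
    kerSMul φ N ≤ (kerSMul φ M).map p.lin := by
  rw [kerSMul, Submodule.span_le]
  rintro _ ⟨a, n, ha, rfl⟩
  obtain ⟨m, rfl⟩ := hp n
  exact ⟨a • m, smul_mem_kerSMul ha m, map_smul _ _ _⟩

/-- If the kernel of `φ` is generated by an idempotent `e`, and `Y` is a submodule of `M` that
contains `e M`, then `I M ⊆ I Y`. -/
theorem kerSMul_le_map_of_idempotent {Y : FDMod k A} (i : Y ⟶ M) {e : A}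
    (he : IsIdempotentElem e) (hφ : ∀ a, φ a = 0 ↔ a ∈ TwoSidedIdeal.span {e})
    (hi : ∀ m : M.carrier, e • m ∈ LinearMap.range i.lin) :
    kerSMul φ M ≤ (kerSMul φ Y).map i.lin := by
  rw [kerSMul, Submodule.span_le]
  rintro _ ⟨a, m, ha, rfl⟩
  rw [hφ] at ha
  -- The element `m` must vary, since right multiplication by `b` replaces it by `b • m`.
  induction ha using TwoSidedIdeal.span_induction generalizing m with
  | mem x hx =>
    obtain rfl := Set.mem_singleton_iff.1 hx
    -- Write `e m = e (e m)`: the inner `e` moves `m` into `Y`, and the outer one is still available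
    -- as an element of `I`.
    obtain ⟨y, hy⟩ := hi m
    refine ⟨x • y, smul_mem_kerSMul ((hφ x).2 (TwoSidedIdeal.subset_span hx)) y, ?_⟩
    rw [map_smul, hy, ← mul_smul, he.eq]
  | zero => rw [zero_smul]; exact zero_mem _
  | add x y _ _ hx hy => rw [add_smul]; exact add_mem (hx m) (hy m)
  | neg x _ hx => rw [neg_smul]; exact neg_mem (hx m)
  | left_absorb a x _ hx => rw [mul_smul]; exact Submodule.smul_mem _ a (hx m)
  | right_absorb b x _ hx => rw [mul_smul]; exact hx (b • m)

variable [FiniteDimensional k B]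

variable (φ M) in
/-- The `φ`-semilinear map `m ↦ 1 ⊗ m`. -/
def tensorUnit : M.carrier →ₛₗ[(φ : A →+* B)] (tensorObj φ M).carrier where
  toFun m := tensorTmul φ M 1 m
  map_add' m n := by
    change (balanced φ M).mkQ _ = (balanced φ M).mkQ _ + (balanced φ M).mkQ _
    rw [TensorProduct.tmul_add, map_add]
  map_smul' a m := by
    change (balanced φ M).mkQ _ = φ a • (balanced φ M).mkQ _
    rw [← map_smul, ← sub_eq_zero, ← map_sub, Submodule.mkQ_apply, Submodule.Quotient.mk_eq_zero,
      ← neg_mem_iff, neg_sub]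
    refine Submodule.subset_span ⟨1, a, m, ?_⟩
    rw [one_mul, TensorProduct.smul_tmul', smul_eq_mul, mul_one]

theorem tensorTmul_eq_smul (b : B) (m : M.carrier) :
    tensorTmul φ M b m = b • tensorUnit φ M m := by
  change (balanced φ M).mkQ _ = b • (balanced φ M).mkQ _
  rw [← map_smul, TensorProduct.smul_tmul', smul_eq_mul, mul_one]

theorem tensorUnit_surjective (hφ : Function.Surjective φ) :
    Function.Surjective (tensorUnit φ M) := by
  intro x
  obtain ⟨y, rfl⟩ := (balanced φ M).mkQ_surjective x
  induction y using TensorProduct.induction_on with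
  | zero => exact ⟨0, (map_zero _).trans (map_zero _).symm⟩
  | tmul b m =>
    obtain ⟨a, rfl⟩ := hφ b
    refine ⟨a • m, ?_⟩
    rw [LinearMap.map_smulₛₗ]
    exact (tensorTmul_eq_smul (φ a) m).symm
  | add y z hy hz =>
    obtain ⟨m, hm⟩ := hy
    obtain ⟨n, hn⟩ := hz
    exact ⟨m + n, by rw [map_add, map_add, hm, hn]; rfl⟩

theorem tensorFunctor_map_unit {N : FDMod k A} (f : M ⟶ N) (m : M.carrier) :
    ((tensorFunctor φ).map f).lin (tensorUnit φ M m) = tensorUnit φ N (f.lin m) := rfl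

/-- The universal property of `B ⊗_A M`. -/
theorem exists_tensor_desc {N : Type*} [AddCommGroup N] [Module B N]
    (f : M.carrier →ₛₗ[(φ : A →+* B)] N) :
    ∃ g : (tensorObj φ M).carrier →ₗ[B] N, ∀ m, g (tensorUnit φ M m) = f m := by
  -- `N` carries only a `B`-action; the induced `k`-action is what allows a lift from the tensor
  -- product over `k`.
  let : Module k N := Module.compHom N (algebraMap k B)
  have hk : ∀ (c : k) (n : N), c • n = algebraMap k B c • n := fun _ _ => rfl
  have : IsScalarTower k B N := ⟨fun c b n => by rw [hk, Algebra.smul_def, mul_smul]⟩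
  let f' : M.carrier →ₗ[k] N :=
    { toFun := f
      map_add' := map_add f
      map_smul' := fun c m => by
        rw [← algebraMap_smul A c m, LinearMap.map_smulₛₗ, RingHom.id_apply, hk]
        exact congrArg (· • f m) (φ.commutes c) }
  have : SMulCommClass k B N := IsScalarTower.to_smulCommClass
  have : SMulCommClass B k N := SMulCommClass.symm k B N
  let g' : B ⊗[k] M.carrier →ₗ[B] N :=
    TensorProduct.AlgebraTensorModule.lift (LinearMap.toSpanSingleton B (M.carrier →ₗ[k] N) f')
  have hg' : ∀ b m, g' (b ⊗ₜ m) = b • f m := fun _ _ => rfl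
  refine ⟨(balanced φ M).liftQ g' ?_, fun m => ?_⟩
  · rw [balanced, Submodule.span_le]
    rintro _ ⟨b, a, m, rfl⟩
    rw [SetLike.mem_coe, LinearMap.mem_ker, map_sub, hg', hg', LinearMap.map_smulₛₗ, mul_smul,
      sub_eq_zero]
    rfl
  · exact (hg' 1 m).trans (one_smul B (f m))

theorem tensor_linearMap_ext {N : Type*} [AddCommGroup N] [Module B N]
    {s t : (tensorObj φ M).carrier →ₗ[B] N}
    (h : ∀ m, s (tensorUnit φ M m) = t (tensorUnit φ M m)) : s = t := by
  refine Submodule.linearMap_qext (balanced φ M) (LinearMap.ext fun y => ?_)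
  induction y using TensorProduct.induction_on with
  | zero => rw [map_zero, map_zero]
  | tmul b m =>
    change s (tensorTmul φ M b m) = t (tensorTmul φ M b m)
    rw [tensorTmul_eq_smul, map_smul, map_smul, h]
  | add y z hy hz => rw [map_add, map_add, hy, hz]

/-- Base change preserves projectivity. -/
theorem projective_tensorObj (hM : Module.Projective A M.carrier) :
    Module.Projective B (tensorObj φ M).carrier := by
  refine Module.Projective.of_lifting_property'' fun p hp => ?_
  -- It suffices to split a surjection `p` from this free module. Restrict scalars along `φ`, lift
  -- the unit map of `M` through `p`, and return to `B`-modules by the universal property.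
  let : Module A ((tensorObj φ M).carrier →₀ B) := Module.compHom _ (φ : A →+* B)
  let : Module A (tensorObj φ M).carrier := Module.compHom _ (φ : A →+* B)
  let p' : ((tensorObj φ M).carrier →₀ B) →ₗ[A] (tensorObj φ M).carrier :=
    { toFun := p, map_add' := map_add p, map_smul' := fun a x => map_smul p (φ a) x }
  let η : M.carrier →ₗ[A] (tensorObj φ M).carrier :=
    { toFun := tensorUnit φ M, map_add' := map_add _
      map_smul' := fun a x => LinearMap.map_smulₛₗ (tensorUnit φ M) a x }
  obtain ⟨w, hw⟩ := Module.projective_lifting_property p' η hp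
  let w' : M.carrier →ₛₗ[(φ : A →+* B)] ((tensorObj φ M).carrier →₀ B) :=
    { toFun := w, map_add' := map_add w, map_smul' := fun a x => map_smul w a x }
  obtain ⟨g, hg⟩ := exists_tensor_desc w'
  refine ⟨g, tensor_linearMap_ext fun m => ?_⟩
  rw [LinearMap.comp_apply, hg]
  exact LinearMap.congr_fun hw m

/-- Identifies `B ⊗_A M` with `M / IM`. Since `I` acts as zero on `M / IM` and `φ` is surjective,
that quotient is a `B`-module, so `M → M / IM` factors through `B ⊗_A M` and the unit kills nothing
outside `IM`. -/
theorem tensorUnit_eq_zero (hφ : Function.Surjective φ) (m : M.carrier) :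
    tensorUnit φ M m = 0 ↔ m ∈ kerSMul φ M := by
  constructor
  · intro hm
    let ρ : B →+* AddMonoid.End (M.carrier ⧸ kerSMul φ M) :=
      RingHom.liftOfSurjective (φ : A →+* B) hφ
        ⟨Module.toAddMonoidEnd A (M.carrier ⧸ kerSMul φ M), fun a ha => by
          refine AddMonoidHom.ext fun x => ?_
          obtain ⟨y, rfl⟩ := (kerSMul φ M).mkQ_surjective x
          exact (Submodule.Quotient.mk_eq_zero _).2 (smul_mem_kerSMul ha y)⟩
    let : Module B (M.carrier ⧸ kerSMul φ M) := Module.compHom _ ρ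
    obtain ⟨g, hg⟩ := exists_tensor_desc (φ := φ) (M := M) (N := M.carrier ⧸ kerSMul φ M)
      { toFun := (kerSMul φ M).mkQ
        map_add' := map_add _
        map_smul' := fun a x => by
          rw [map_smul]
          have hρ : ρ (φ a) = Module.toAddMonoidEnd A (M.carrier ⧸ kerSMul φ M) a :=
            RingHom.liftOfSurjective_comp_apply (φ : A →+* B) hφ _ a
          exact (DFunLike.congr_fun hρ ((kerSMul φ M).mkQ x)).symm }
    have := hg m
    rw [hm, map_zero] at this
    exact (Submodule.Quotient.mk_eq_zero _).1 this.symm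
  · intro hm
    induction hm using Submodule.span_induction with
    | mem x hx =>
      obtain ⟨a, n, ha, rfl⟩ := hx
      rw [LinearMap.map_smulₛₗ, RingHom.coe_coe, ha, zero_smul]
    | zero => exact map_zero _
    | add x y _ _ hx hy => rw [map_add, hx, hy, add_zero]
    | smul a x _ hx => rw [LinearMap.map_smulₛₗ, hx, smul_zero]

/-- Base change along the quotient by an idempotent ideal `A e A` preserves short exact sequences
whose right end is annihilated by `e`. -/
theorem IsShortExact.tensor {X Y Z : FDMod k A} {i : X ⟶ Y} {p : Y ⟶ Z} (h : IsShortExact i p)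
    (hφ : Function.Surjective φ) {e : A} (he : IsIdempotentElem e)
    (hker : ∀ a, φ a = 0 ↔ a ∈ TwoSidedIdeal.span {e}) (hZ : ∀ z : Z.carrier, e • z = 0) :
    IsShortExact ((tensorFunctor φ).map i) ((tensorFunctor φ).map p) := by
  refine ⟨?_, ?_, ?_⟩
  · rw [injective_iff_map_eq_zero]
    intro x' hx
    obtain ⟨x, rfl⟩ := tensorUnit_surjective hφ x'
    rw [tensorFunctor_map_unit] at hx
    replace hx := (tensorUnit_eq_zero hφ _).1 hx
    -- As `e` kills `Z`, exactness puts `e • y` in the image of `i` for every `y`.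
    obtain ⟨x₁, hx₁, hxx⟩ := kerSMul_le_map_of_idempotent i he hker
      (fun y => (h.2.1 _).1 (by rw [map_smul, hZ])) hx
    rw [← h.1 hxx]
    exact (tensorUnit_eq_zero hφ _).2 hx₁
  · intro y'
    obtain ⟨y, rfl⟩ := tensorUnit_surjective hφ y'
    constructor
    · intro hy
      rw [tensorFunctor_map_unit] at hy
      replace hy := (tensorUnit_eq_zero hφ _).1 hy
      obtain ⟨y₁, hy₁, hyy⟩ := kerSMul_le_map p h.2.2 hy
      -- Subtracting `y₁ ∈ IY` leaves the class of `y` unchanged and makes its image in `Z` vanish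
      -- exactly.
      obtain ⟨x, hx⟩ := (h.2.1 (y - y₁)).1 (by rw [map_sub, hyy, sub_self])
      refine ⟨tensorUnit φ X x, ?_⟩
      rw [tensorFunctor_map_unit, hx, map_sub, (tensorUnit_eq_zero hφ _).2 hy₁, sub_zero]
    · rintro ⟨x', hx⟩
      obtain ⟨x, rfl⟩ := tensorUnit_surjective hφ x'
      rw [← hx, tensorFunctor_map_unit, tensorFunctor_map_unit, h.2.1.apply_apply_eq_zero]
      exact map_zero _
  · intro z'
    obtain ⟨z, rfl⟩ := tensorUnit_surjective hφ z'
    obtain ⟨y, rfl⟩ := h.2.2 z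
    exact ⟨tensorUnit φ Y y, tensorFunctor_map_unit p y⟩

end

/-! ### The sequence of the Auslander algebra -/

section

variable {k : Type v} {Λ : Type u} [Field k] [Ring Λ] [Algebra k Λ] {E : FDMod k Λ}

theorem isIdempotentElem_idem (s : RegularSummand E) : IsIdempotentElem s.idem := by
  refine MulOpposite.unop_injective (LinearMap.ext fun x => ?_)
  exact congrArg s.inc (LinearMap.congr_fun s.proj_comp_inc (s.proj x))

theorem quotMap_surjective (s : RegularSummand E) : Function.Surjective (quotMap (k := k) s) :=
  RingCon.mkₐ_surjective (α := k) (TwoSidedIdeal.span {s.idem}).ringCon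

theorem quotMap_eq_zero (s : RegularSummand E) (γ : AuslanderAlgebra E) :
    quotMap (k := k) s γ = 0 ↔ γ ∈ TwoSidedIdeal.span {s.idem} := by
  rw [TwoSidedIdeal.mem_iff]
  exact RingCon.eq _

/-- For `0 → L → M → N → 0` exact, `0 → α(f) → (E, N) → α(g) → 0` is exact. -/
theorem isShortExact_alpha (E : FDMod k Λ) (f : SubmoduleCategory k Λ) :
    IsShortExact ((alphaToHom E).app f) ((homToAlpha E).app f) := by
  refine ⟨?_, ?_, Submodule.mkQ_surjective _⟩
  · rw [injective_iff_map_eq_zero]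
    intro x hx
    obtain ⟨h, rfl⟩ := Submodule.mkQ_surjective _ x
    change E.carrier →ₗ[Λ] f.obj.right.carrier at h
    have hx' : ((LinearMap.range f.obj.hom.lin).mkQ).comp h = 0 := hx
    refine (Submodule.Quotient.mk_eq_zero _).2 ?_
    -- A map `E → M` that vanishes in `N` takes values in the image of `L`, so it lifts to `L` by
    -- injectivity of `f`.
    have hmem : ∀ y, h y ∈ LinearMap.range f.obj.hom.lin := fun y =>
      (Submodule.Quotient.mk_eq_zero _).1 (LinearMap.congr_fun hx' y)
    refine ⟨((LinearEquiv.ofInjective f.obj.hom.lin f.property).symm.toLinearMap.comp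
      (LinearMap.codRestrict _ h hmem)), LinearMap.ext fun y => ?_⟩
    exact congrArg Subtype.val
      ((LinearEquiv.ofInjective f.obj.hom.lin f.property).apply_symm_apply ⟨h y, hmem y⟩)
  · intro y
    constructor
    · intro hy
      obtain ⟨h, rfl⟩ := (Submodule.Quotient.mk_eq_zero _).1 hy
      exact ⟨Submodule.Quotient.mk h, rfl⟩
    · rintro ⟨x, rfl⟩
      obtain ⟨h, rfl⟩ := Submodule.mkQ_surjective _ x
      exact (Submodule.Quotient.mk_eq_zero _).2 ⟨h, rfl⟩

/-- The idempotent of the regular summand annihilates `α(g)` for `g` an epimorphism. -/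
theorem idem_smul_alpha (s : RegularSummand E) {g : Arrow (FDMod k Λ)}
    (hg : Function.Surjective g.hom.lin) (x : ((alpha E).obj g).carrier) : s.idem • x = 0 := by
  obtain ⟨h, rfl⟩ := Submodule.mkQ_surjective _ x
  change E.carrier →ₗ[Λ] g.right.carrier at h
  -- The element `s.idem • h` factors through `Λ`, where a map is determined by its value at `1`;
  -- lifting this value along `g` lifts the whole map.
  obtain ⟨m, hm⟩ := hg (h (s.inc 1))
  refine (Submodule.Quotient.mk_eq_zero _).2
    ⟨(LinearMap.toSpanSingleton Λ g.left.carrier m).comp s.proj, LinearMap.ext fun y => ?_⟩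
  change g.hom.lin (s.proj y • m) = h (s.inc (s.proj y))
  rw [map_smul, hm, ← map_smul, ← map_smul, smul_eq_mul, mul_one]

theorem free_homObj_self (E : FDMod k Λ) :
    Module.Free (AuslanderAlgebra E) (homObj E E).carrier := by
  let ε : AuslanderAlgebra E ≃ₗ[AuslanderAlgebra E] (homObj E E).carrier :=
    { toFun := MulOpposite.unop
      invFun := MulOpposite.op
      map_add' := fun _ _ => rfl
      map_smul' := fun _ _ => rfl
      left_inv := fun _ => rfl
      right_inv := fun _ => rfl }
  exact Module.Free.of_equiv ε

/-- If `M` belongs to `add E`, then `(E, M)` is projective. -/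
theorem MemAdd.projective_homObj {M : FDMod k Λ} (h : MemAdd E M) :
    Module.Projective (AuslanderAlgebra E) (homObj E M).carrier := by
  obtain ⟨n, i, p, hpi⟩ := h
  have := free_homObj_self E
  -- `ι` and `π` are `(E, i)` and `(E, p)` after identifying `(E, Eⁿ)` with `(E, E)ⁿ`, so the
  -- splitting of `M` off `Eⁿ` is inherited.
  let ι : (homObj E M).carrier →ₗ[AuslanderAlgebra E] (Fin n → (homObj E E).carrier) :=
    { toFun := fun h j => ((LinearMap.proj j).comp i).comp h
      map_add' := fun h h' => funext fun j => 
        LinearMap.comp_add (M := E.carrier) h h' ((LinearMap.proj j).comp i)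
      map_smul' := fun _ _ => rfl }
  let π : (Fin n → (homObj E E).carrier) →ₗ[AuslanderAlgebra E] (homObj E M).carrier :=
    { toFun := fun h => p.comp (LinearMap.pi h)
      map_add' := fun h h' => LinearMap.comp_add (LinearMap.pi h) (LinearMap.pi h') p
      map_smul' := fun _ _ => rfl }
  refine Module.Projective.of_split ι π (LinearMap.ext fun h => LinearMap.ext fun x => ?_)
  exact LinearMap.congr_fun hpi ((show E.carrier →ₗ[Λ] M.carrier from h) x)

theorem isShortExact_functorF_functorG (s : RegularSummand E) (f : SubmoduleCategory k Λ) :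
    IsShortExact ((fromF s).app f) ((toG s).app f) :=
  (isShortExact_alpha E f).tensor (quotMap_surjective s) (isIdempotentElem_idem s)
    (quotMap_eq_zero s) (idem_smul_alpha s (Submodule.mkQ_surjective _))

end

end FDMod

theorem theorem2 {k : Type v} {Λ : Type u} [Field k] [Ring Λ] [Algebra k Λ]
    [FiniteDimensional k Λ]
    (hbasic : IsBasicAlgebra k Λ)
    (hself : Module.Injective.{u, u} Λ Λ)
    (hfin : IsRepresentationFinite k Λ)
    (E : FDMod k Λ) (hE : E.IsAdditiveGenerator)
    (s : FDMod.RegularSummand E) :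
    (∀ f : FDMod.SubmoduleCategory k Λ,
      FDMod.IsShortExact ((FDMod.fromF s).app f) ((FDMod.toG s).app f) ∧
      Module.Projective (FDMod.StableAuslanderAlgebra s) ((FDMod.functorMid s).obj f).carrier) ∧
    ∃ Φ : FDMod.functorF s ⋙ FDMod.toStable k (FDMod.StableAuslanderAlgebra s) ≅
        (FDMod.functorG s ⋙ FDMod.toStable k (FDMod.StableAuslanderAlgebra s)) ⋙
          FDMod.Ω k (FDMod.StableAuslanderAlgebra s),
      ∀ f : FDMod.SubmoduleCategory k Λ,
        ∃ (w : (FDMod.functorMid s).obj f ⟶ FDMod.cover ((FDMod.functorG s).obj f))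
          (t : (FDMod.functorF s).obj f ⟶ FDMod.syzygy ((FDMod.functorG s).obj f)),
          w ≫ FDMod.coverMap ((FDMod.functorG s).obj f) = (FDMod.toG s).app f ∧
          (FDMod.fromF s).app f ≫ w = t ≫ FDMod.syzygyInc ((FDMod.functorG s).obj f) ∧
          Φ.hom.app f = (FDMod.toStable k (FDMod.StableAuslanderAlgebra s)).map t := by
  have hproj : ∀ f, Module.Projective (FDMod.StableAuslanderAlgebra s)
      ((FDMod.functorMid s).obj f).carrier := fun f =>
    FDMod.projective_tensorObj (hE.2 _).projective_homObj
  exact ⟨fun f => ⟨FDMod.isShortExact_functorF_functorG s f, hproj f⟩,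
    FDMod.exists_iso_syzygy (FDMod.fromF s) (FDMod.toG s)
      (FDMod.isShortExact_functorF_functorG s) hproj⟩
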